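/- Let $d\ge 1$. There exists a finite constant $C_d$, depending only on $d$, such that the following holds. Let $K\subset\mathbb{R}^d$ be a compact set whose topological boundary $\partial K$ is $\mathcal{H}^{d-1}$-rectifiable, i.e. up to an $\mathcal{H}^{d-1}$-null set $\partial K$ is covered by countably many Lipschitz images of $\mathbb{R}^{d-1}$, and let $u,v:K\to\mathbb{R}$ be two Lipschitz functions that are convex on every segment included in $K$. Then $$\|\nabla u-\nabla v\|_{L^2(K)}^2\le C_d\,\mathcal{H}^{d-1}(\partial K)^{2/3}\,\bigl(\|\nabla u\|_{L^\infty(K)}+\|\nabla v\|_{L^\infty(K)}\bigr)^{4/3}\,\|u-v\|_{L^2(K)}^{2/3},$$ where $\mathcal{H}^{d-1}$ is the $(d-1)$-dimensional Hausdorff measure, the norms are with respect to Lebesgue measure on $K$ and the Euclidean norm of $\mathbb{R}^d$, and $\nabla u,\nabla v$ are the gradients, which exist almost everywhere on $K$. (If $\mathcal{H}^{d-1}(\partial K)=+\infty$, the inequality is understood in $[0,+\infty]$ with $0\cdot\infty=0$.) -/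

import Mathlib

open MeasureTheory
open scoped NNReal ENNReal

/-- `S` is countably `ℋ^k`-rectifiable: up to an `ℋ^k`-null set, it is covered by countably many
Lipschitz images of `ℝ^k`. Finiteness of `ℋ^k(S)` is not required. -/
def IsHausdorffRectifiable {X : Type*} [MetricSpace X] [MeasurableSpace X] [BorelSpace X]
    (k : ℕ) (S : Set X) : Prop :=
  ∃ f : ℕ → EuclideanSpace ℝ (Fin k) → X,
    (∀ i, ∃ L : ℝ≥0, LipschitzWith L (f i)) ∧ μH[(k : ℝ)] (S \ ⋃ i, Set.range (f i)) = 0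

/-- `u` is convex on every segment contained in `K`. -/
def ConvexOnSegments {E : Type*} [AddCommGroup E] [Module ℝ E] (K : Set E) (u : E → ℝ) : Prop :=
  ∀ x y : E, segment ℝ x y ⊆ K → ConvexOn ℝ (segment ℝ x y) u

/-! ### One dimension: two convex functions on an interval -/

section OneDim

open Set

/-! The proof slices `K` by lines parallel to the axes and uses a one-dimensional estimate that is
additive over intervals.

On an interval, let `w = f - g` with `f`, `g` convex. Then `w' = P - Q` with `P`, `Q` monotone, `|P|
≤ A`, `|Q| ≤ B`, and `∫ w'² = ∫ P w' - ∫ Q w'`. A bounded monotone function is a superposition of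
indicators of half-lines, against which `w'` integrates to a difference of two values of `w`; hence
`∫ w'² ≤ 6 (A + B) sup |w|`. As `w` is `M`-Lipschitz for `M = A + B`, its supremum is controlled by
its `L²` norm and a length scale `l`. With Young's inequality this becomes `∫ w'² ≤ 9 M² l + (6 /
l²) ∫ w²`, for every `l > 0` and every interval (`integral_sq_sub_monotone_le`).

The same `l` serves all intervals, so summing over the components of a slice of `interior K`
multiplies the first term by at most the number of boundary points on that line. The integral of
this number over all parallel lines is at most `ℋ^(d-1)(∂K)`, by Eilenberg's inequality
(`exists_measurable_card_le_lintegral_le_hausdorffMeasure`). Summing over the `d` directions and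
optimising `l` gives the exponents `2/3, 4/3, 2/3` and `C = 15 d`. Rectifiability serves to make
`∂K` Lebesgue null, so that `K` may be replaced by its interior. -/

/-- The integral of a right derivative over the trace of an upper set is bounded by the
oscillation of the primitive. -/
theorem abs_setIntegral_isUpperSet_le {a b m : ℝ} (hab : a ≤ b) {w r : ℝ → ℝ}
    (hw : ContinuousOn w (Icc a b))
    (hd : ∀ t ∈ Ioo a b, HasDerivWithinAt w (r t) (Ioi t) t)
    (hr : IntervalIntegrable r volume a b) (hm : ∀ t ∈ Icc a b, |w t| ≤ m)
    {S : Set ℝ} (hS : IsUpperSet S) :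
    |∫ t in Ioc a b ∩ S, r t| ≤ 2 * m := by
  have hm0 : 0 ≤ m := (abs_nonneg _).trans (hm a ⟨le_rfl, hab⟩)
  rcases (Ioc a b ∩ S).eq_empty_or_nonempty with he | hne
  · rw [he]; simpa using hm0
  -- The trace of an upper set is an interval ending at `b`; up to its left endpoint it is `Ioc c
  -- b`, so the integral is `w b - w c`.
  set c := sInf (Ioc a b ∩ S) with hc
  have hbdd : BddBelow (Ioc a b ∩ S) := ⟨a, fun t ht => ht.1.1.le⟩
  have hac : a ≤ c := le_csInf hne fun t ht => ht.1.1.le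
  have hcb : c ≤ b := by
    obtain ⟨t, ht⟩ := hne
    exact (csInf_le hbdd ht).trans ht.1.2
  have h1 : Ioc c b ⊆ Ioc a b ∩ S := by
    intro t ht
    obtain ⟨s, hs, hst⟩ := exists_lt_of_csInf_lt hne ht.1
    exact ⟨⟨hac.trans_lt ht.1, ht.2⟩, hS hst.le hs.2⟩
  have h2 : Ioc a b ∩ S ⊆ Icc c b := fun t ht => ⟨csInf_le hbdd ht, ht.1.2⟩
  have hae : (Ioc a b ∩ S : Set ℝ) =ᵐ[volume] Ioc c b :=
    Filter.EventuallyLE.antisymm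
      (h2.eventuallyLE.trans (Ioc_ae_eq_Icc (μ := volume)).symm.le) h1.eventuallyLE
  have hFTC : ∫ t in c..b, r t = w b - w c := by
    apply intervalIntegral.integral_eq_sub_of_hasDeriv_right
    · rw [uIcc_of_le hcb]; exact hw.mono (Icc_subset_Icc_left hac)
    · intro x hx
      rw [min_eq_left hcb, max_eq_right hcb] at hx
      exact hd x ⟨hac.trans_lt hx.1, hx.2⟩
    · exact hr.mono_set (by
        rw [uIcc_of_le hcb, uIcc_of_le hab]; exact Icc_subset_Icc_left hac)
  rw [setIntegral_congr_set hae, ← intervalIntegral.integral_of_le hcb, hFTC]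
  have h3 := abs_le.1 (hm b ⟨hab, le_rfl⟩)
  have h4 := abs_le.1 (hm c ⟨hac, hcb⟩)
  rw [abs_le]; constructor <;> linarith

/-- Layer-cake decomposition of a number in `[-A, A]`. -/
theorem integral_ite_lt_eq {A p : ℝ} (hp : |p| ≤ A) :
    ∫ s in Ioc (-A) A, (if s < p then (1 : ℝ) else 0) = p + A := by
  have h := abs_le.1 hp
  have : (fun s : ℝ => if s < p then (1 : ℝ) else 0) = (Iio p).indicator (fun _ => 1) := by
    ext s; simp [indicator]
  rw [this, integral_indicator measurableSet_Iio, setIntegral_const, measureReal_restrict_apply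
    measurableSet_Iio]
  have h2 : (Iio p ∩ Ioc (-A) A : Set ℝ) = Ioo (-A) p := by
    ext s; simp only [mem_inter_iff, mem_Iio, mem_Ioc, mem_Ioo]
    constructor
    · rintro ⟨h1, h2, -⟩; exact ⟨h2, h1⟩
    · rintro ⟨h1, h2⟩; exact ⟨h2, h1, by linarith⟩
  rw [h2, Real.volume_real_Ioo_of_le h.1]; simp

/-- A second mean value estimate: testing a derivative against a bounded monotone function is
controlled by the sup norm of the primitive. -/
theorem abs_integral_monotone_mul_le {a b m A M : ℝ} (hab : a ≤ b) {w r P : ℝ → ℝ}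
    (hw : ContinuousOn w (Icc a b))
    (hd : ∀ t ∈ Ioo a b, HasDerivWithinAt w (r t) (Ioi t) t)
    (hrm : Measurable r) (hrM : ∀ t, |r t| ≤ M)
    (hm : ∀ t ∈ Icc a b, |w t| ≤ m) (hP : Monotone P) (hPA : ∀ t, |P t| ≤ A) :
    |∫ t in Ioc a b, P t * r t| ≤ 6 * A * m := by
  have hm0 : 0 ≤ m := (abs_nonneg _).trans (hm a ⟨le_rfl, hab⟩)
  have hA0 : 0 ≤ A := (abs_nonneg _).trans (hPA a)
  have hri : Integrable r (volume.restrict (Ioc a b)) :=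
    Integrable.of_bound hrm.aestronglyMeasurable M (ae_of_all _ fun t => by simpa using hrM t)
  have hrI : IntervalIntegrable r volume a b := by
    rw [intervalIntegrable_iff_integrableOn_Ioc_of_le hab]; exact hri
  have hF : Integrable (Function.uncurry fun t s : ℝ => (if s < P t then (1 : ℝ) else 0) * r t)
      ((volume.restrict (Ioc a b)).prod (volume.restrict (Ioc (-A) A))) := by
    apply Integrable.of_bound (C := M)
    · apply Measurable.aestronglyMeasurable
      apply Measurable.mul
      · exact Measurable.ite (measurableSet_lt measurable_snd (hP.measurable.comp measurable_fst))
          measurable_const measurable_const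
      · exact hrm.comp measurable_fst
    · refine ae_of_all _ fun z => ?_
      simp only [Function.uncurry, norm_mul, Real.norm_eq_abs]
      have := hrM z.1
      split_ifs <;> simp <;> linarith [abs_nonneg (r z.1)]
  have h1 : ∀ t, P t * r t
      = (∫ s in Ioc (-A) A, (if s < P t then (1 : ℝ) else 0) * r t) - A * r t := by
    intro t
    rw [integral_mul_const, integral_ite_lt_eq (hPA t)]; ring
  -- Fubini in the level `s`: the superlevel sets of `P` are upper sets. Levels fill a length `2A`,
  -- each costing `2m`, and the shift by `A` costs `2Am` more, whence `6Am`.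
  have h2 : ∫ t in Ioc a b, P t * r t
      = (∫ s in Ioc (-A) A, ∫ t in Ioc a b ∩ {t | s < P t}, r t) - A * ∫ t in Ioc a b, r t := by
    simp_rw [h1]
    have hL : Integrable (fun t => ∫ s in Ioc (-A) A, (if s < P t then (1 : ℝ) else 0) * r t)
        (volume.restrict (Ioc a b)) := hF.integral_prod_left
    rw [integral_sub hL (hri.const_mul A), integral_const_mul,
      integral_integral_swap hF]
    congr 2
    ext s
    have hms : MeasurableSet {t | s < P t} := measurableSet_lt measurable_const hP.measurable
    rw [← setIntegral_indicator hms]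
    congr 1; ext t; simp [indicator]
  have hup : ∀ s, |∫ t in Ioc a b ∩ {t | s < P t}, r t| ≤ 2 * m := fun s =>
    abs_setIntegral_isUpperSet_le hab hw hd hrI hm fun x y hxy hx => lt_of_lt_of_le hx (hP hxy)
  have hun : |∫ t in Ioc a b, r t| ≤ 2 * m := by
    simpa using abs_setIntegral_isUpperSet_le hab hw hd hrI hm isUpperSet_univ
  have h3 : |∫ s in Ioc (-A) A, ∫ t in Ioc a b ∩ {t | s < P t}, r t| ≤ 2 * m * (2 * A) := by
    have := norm_setIntegral_le_of_norm_le_const (μ := volume) (s := Ioc (-A) A)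
      (f := fun s => ∫ t in Ioc a b ∩ {t | s < P t}, r t) (C := 2 * m) (by simp)
      (fun s _ => by simpa using hup s)
    rw [Real.volume_real_Ioc_of_le (by linarith)] at this
    simp only [Real.norm_eq_abs] at this
    linarith
  rw [h2]
  calc _ ≤ |∫ s in Ioc (-A) A, ∫ t in Ioc a b ∩ {t | s < P t}, r t| + |A * ∫ t in Ioc a b, r t| :=
        abs_sub _ _
    _ ≤ 2 * m * (2 * A) + A * (2 * m) := by
        rw [abs_mul, abs_of_nonneg hA0]
        gcongr
    _ = 6 * A * m := by ring

/-- If `w` is `M`-Lipschitz then its sup norm on an interval of length at least `l` is controlled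
by its `L²` norm and `M * l`. -/
theorem mul_sq_le_integral_sq {a b M l : ℝ} (hl : 0 < l) (hlb : l ≤ b - a) {w : ℝ → ℝ}
    (hw : ContinuousOn w (Icc a b))
    (hLip : ∀ s ∈ Icc a b, ∀ t ∈ Icc a b, |w s - w t| ≤ M * |s - t|)
    {x : ℝ} (hx : x ∈ Icc a b) :
    l * w x ^ 2 ≤ 2 * (∫ t in Ioc a b, w t ^ 2) + 2 * M ^ 2 * l ^ 3 := by
  -- A window of length exactly `l` inside the interval and containing `x`, over which the pointwise
  -- bound is averaged.
  obtain ⟨c, hac, hcb, hcx, hxc⟩ : ∃ c, a ≤ c ∧ c + l ≤ b ∧ c ≤ x ∧ x ≤ c + l := by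
    rcases le_total (x + l) b with h | h
    · exact ⟨x, hx.1, h, le_rfl, by linarith⟩
    · exact ⟨b - l, by linarith, by linarith, by linarith, by linarith [hx.2]⟩
  have hM : 0 ≤ M := by
    have := (abs_nonneg _).trans (hLip a ⟨le_rfl, by linarith⟩ b ⟨by linarith, le_rfl⟩)
    by_contra hneg
    have h1 : 0 < |a - b| := abs_pos.2 (by linarith)
    nlinarith
  have hint : IntegrableOn (fun t => w t ^ 2) (Icc a b) := (hw.pow 2).integrableOn_Icc
  have hsub : Ioc c (c + l) ⊆ Ioc a b := Ioc_subset_Ioc hac hcb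
  have hint1 : IntegrableOn (fun t => w t ^ 2) (Ioc a b) := hint.mono_set Ioc_subset_Icc_self
  have hint2 : IntegrableOn (fun t => w t ^ 2) (Ioc c (c + l)) := hint1.mono_set hsub
  have hpt : ∀ t ∈ Ioc c (c + l), w x ^ 2 ≤ 2 * w t ^ 2 + 2 * M ^ 2 * l ^ 2 := by
    intro t ht
    have h1 := hLip x hx t ⟨hac.trans ht.1.le, ht.2.trans hcb⟩
    have h2 : |x - t| ≤ l := abs_le.2 ⟨by linarith [ht.2], by linarith [ht.1]⟩
    have h3 : |w x - w t| ≤ M * l := h1.trans (by gcongr)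
    have h4 : (w x - w t) ^ 2 ≤ (M * l) ^ 2 := sq_le_sq' (abs_le.1 h3).1 (abs_le.1 h3).2
    nlinarith [sq_nonneg (w x - 2 * w t)]
  have hc : ∀ y : ℝ, Integrable (fun _ => y) (volume.restrict (Ioc c (c + l))) :=
    fun y => integrable_const y
  have h1 : ∫ t in Ioc c (c + l), w x ^ 2
      ≤ ∫ t in Ioc c (c + l), (2 * w t ^ 2 + 2 * M ^ 2 * l ^ 2) :=
    setIntegral_mono_on (hc _) ((hint2.const_mul 2).add (hc _)) measurableSet_Ioc hpt
  rw [integral_add (hint2.const_mul 2) (hc _), setIntegral_const, setIntegral_const,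
    Real.volume_real_Ioc_of_le (by linarith), integral_const_mul] at h1
  have h2 : ∫ t in Ioc c (c + l), w t ^ 2 ≤ ∫ t in Ioc a b, w t ^ 2 :=
    setIntegral_mono_set hint1 (ae_of_all _ fun t => sq_nonneg _) hsub.eventuallyLE
  simp only [smul_eq_mul] at h1
  nlinarith

/-- Scaled one-dimensional estimate: a difference `w` of primitives of bounded monotone functions
`P` and `Q`. -/
theorem integral_sq_sub_monotone_le {a b A B l : ℝ} (hab : a ≤ b) (hl : 0 < l) {w P Q : ℝ → ℝ}
    (hw : ContinuousOn w (Icc a b))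
    (hd : ∀ t ∈ Ioo a b, HasDerivWithinAt w (P t - Q t) (Ioi t) t)
    (hP : Monotone P) (hPA : ∀ t, |P t| ≤ A) (hQ : Monotone Q) (hQB : ∀ t, |Q t| ≤ B) :
    ∫ t in Ioc a b, (P t - Q t) ^ 2
      ≤ 9 * (A + B) ^ 2 * l + 6 / l ^ 2 * ∫ t in Ioc a b, w t ^ 2 := by
  set r : ℝ → ℝ := fun t => P t - Q t with hr
  set M := A + B with hMdef
  have hA0 : 0 ≤ A := (abs_nonneg _).trans (hPA a)
  have hB0 : 0 ≤ B := (abs_nonneg _).trans (hQB a)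
  have hM0 : 0 ≤ M := by positivity
  have hrm : Measurable r := hP.measurable.sub hQ.measurable
  have hrM : ∀ t, |r t| ≤ M := fun t => (abs_sub _ _).trans (add_le_add (hPA t) (hQB t))
  have hX : 0 ≤ ∫ t in Ioc a b, w t ^ 2 := integral_nonneg fun t => sq_nonneg _
  rcases le_total (b - a) l with hs | hs
  -- Intervals shorter than `l`: the first term alone suffices.
  · have h1 : ‖∫ t in Ioc a b, r t ^ 2‖ ≤ M ^ 2 * volume.real (Ioc a b) := by
      apply norm_setIntegral_le_of_norm_le_const (by simp)
      intro t _
      rw [Real.norm_eq_abs, abs_pow]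
      gcongr; exact hrM t
    rw [Real.volume_real_Ioc_of_le hab] at h1
    have h2 : M ^ 2 * (b - a) ≤ M ^ 2 * l := by gcongr
    have h3 := (le_abs_self _).trans h1
    have h4 : 0 ≤ M ^ 2 * l := by positivity
    have h5 : 0 ≤ 6 / l ^ 2 * ∫ t in Ioc a b, w t ^ 2 := by positivity
    linarith
  · have hne : (Icc a b).Nonempty := ⟨a, le_rfl, hab⟩
    obtain ⟨x, hx, hmax⟩ := isCompact_Icc.exists_isMaxOn hne hw.abs
    set m := |w x| with hm
    have hmle : ∀ t ∈ Icc a b, |w t| ≤ m := fun t ht => hmax ht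
    have hLip1 : ∀ s ∈ Icc a b, ∀ t ∈ Icc a b, s ≤ t → |w t - w s| ≤ M * (t - s) := by
      intro s hs' t ht hst
      have hI : IntervalIntegrable r volume s t := by
        rw [intervalIntegrable_iff_integrableOn_Ioc_of_le hst]
        exact Integrable.of_bound hrm.aestronglyMeasurable M
          (ae_of_all _ fun t => by simpa using hrM t)
      have hFTC : ∫ y in s..t, r y = w t - w s := by
        apply intervalIntegral.integral_eq_sub_of_hasDeriv_right _ _ hI
        · rw [uIcc_of_le hst]; exact hw.mono (Icc_subset_Icc hs'.1 ht.2)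
        · intro y hy
          rw [min_eq_left hst, max_eq_right hst] at hy
          exact hd y ⟨hs'.1.trans_lt hy.1, hy.2.trans_le ht.2⟩
      rw [← hFTC]
      have := intervalIntegral.norm_integral_le_of_norm_le_const (a := s) (b := t) (f := r) (C := M)
        (fun y _ => by simpa using hrM y)
      rwa [abs_of_nonneg (by linarith), Real.norm_eq_abs] at this
    have hLip : ∀ s ∈ Icc a b, ∀ t ∈ Icc a b, |w s - w t| ≤ M * |s - t| := by
      intro s hs' t ht
      rcases le_total s t with h | h
      · rw [abs_sub_comm, abs_sub_comm s t, abs_of_nonneg (sub_nonneg.2 h)]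
        exact hLip1 s hs' t ht h
      · rw [abs_of_nonneg (sub_nonneg.2 h)]
        exact hLip1 t ht s hs' h
    have hmX := mul_sq_le_integral_sq hl hs hw hLip hx
    have hPr := abs_integral_monotone_mul_le hab hw hd hrm hrM hmle hP hPA
    have hQr := abs_integral_monotone_mul_le hab hw hd hrm hrM hmle hQ hQB
    have hi : ∀ {R : ℝ → ℝ} {D : ℝ}, Monotone R → (∀ t, |R t| ≤ D) →
        Integrable (fun t => R t * r t) (volume.restrict (Ioc a b)) := by
      intro R D hR hRD
      refine Integrable.of_bound (hR.measurable.mul hrm).aestronglyMeasurable (D * M)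
        (ae_of_all _ fun t => ?_)
      rw [norm_mul]
      exact mul_le_mul (hRD t) (hrM t) (norm_nonneg _) ((abs_nonneg _).trans (hRD t))
    have heq : ∫ t in Ioc a b, r t ^ 2
        = (∫ t in Ioc a b, P t * r t) - ∫ t in Ioc a b, Q t * r t := by
      rw [← integral_sub (hi hP hPA) (hi hQ hQB)]
      congr 1; ext t; simp only [hr]; ring
    have h1 : ∫ t in Ioc a b, r t ^ 2 ≤ 6 * M * m := by
      rw [heq]
      have := (abs_le.1 hPr).2
      have := (abs_le.1 hQr).1
      rw [hMdef]; linarith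
    have hmsq : m ^ 2 = w x ^ 2 := sq_abs _
    rw [← hmsq] at hmX
    -- Young's inequality at scale `l`; substituting the bound on `m ^ 2 / l` gives the constants `3
    -- + 6 = 9` and `3 * 2 = 6`.
    have h2 : 6 * M * m ≤ 3 * M ^ 2 * l + 3 * (m ^ 2 / l) := by
      have : 0 ≤ 3 * l * (M - m / l) ^ 2 := by positivity
      have h3 : 3 * l * (M - m / l) ^ 2 = 3 * M ^ 2 * l + 3 * (m ^ 2 / l) - 6 * M * m := by
        field_simp; ring
      linarith
    have h3 : m ^ 2 / l ≤ 2 / l ^ 2 * (∫ t in Ioc a b, w t ^ 2) + 2 * M ^ 2 * l := by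
      have : m ^ 2 / l = l * m ^ 2 / l ^ 2 := by field_simp
      rw [this, div_le_iff₀ (by positivity)]
      refine hmX.trans (le_of_eq ?_)
      field_simp
    have h4 : 6 / l ^ 2 * ∫ t in Ioc a b, w t ^ 2
        = 3 * (2 / l ^ 2 * (∫ t in Ioc a b, w t ^ 2)) := by ring
    linarith

/-- A convex function on an interval, with derivative a.e. bounded by `A`, has a right derivative
which extends to a monotone function bounded by `A`. -/
theorem ConvexOn.exists_monotone_rightDeriv {a b A : ℝ} (hA : 0 ≤ A) {f f' : ℝ → ℝ}
    (hf : ConvexOn ℝ (Icc a b) f)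
    (hf' : ∀ᵐ t, t ∈ Ioo a b → HasDerivAt f (f' t) t ∧ |f' t| ≤ A) :
    ∃ P : ℝ → ℝ, Monotone P ∧ (∀ t, |P t| ≤ A) ∧
      (∀ t ∈ Ioo a b, HasDerivWithinAt f (P t) (Ioi t) t) ∧
      ∀ᵐ t, t ∈ Ioo a b → f' t = P t := by
  have hint : interior (Icc a b) = Ioo a b := interior_Icc
  set p : ℝ → ℝ := fun t => derivWithin f (Ioi t) t with hp
  have hmono : MonotoneOn p (Ioo a b) := hint ▸ hf.monotoneOn_rightDeriv
  have hpd : ∀ t ∈ Ioo a b, HasDerivWithinAt f (p t) (Ioi t) t := fun t ht =>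
    hf.hasDerivWithinAt_rightDeriv_of_mem_interior (hint ▸ ht)
  have heq : ∀ t, HasDerivAt f (f' t) t → f' t = p t := fun t h =>
    (h.hasDerivWithinAt.derivWithin (uniqueDiffWithinAt_Ioi t)).symm
  -- The bound holds on a dense set, and monotonicity squeezes every interior value between two such
  -- points.
  have hdense : ∀ c d, c < d → c ∈ Icc a b → d ∈ Icc a b → ∃ t ∈ Ioo c d, |p t| ≤ A := by
    intro c d hcd hc hd
    have hpos : volume (Ioo c d) ≠ 0 := by simp [hcd]
    obtain ⟨t, ht, hgood⟩ := (frequently_ae_mem_iff.2 hpos).and_eventually hf' |>.exists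
    have := hgood ⟨hc.1.trans_lt ht.1, ht.2.trans_le hd.2⟩
    exact ⟨t, ht, heq t this.1 ▸ this.2⟩
  have hbd : ∀ t ∈ Ioo a b, |p t| ≤ A := by
    intro t ht
    obtain ⟨s, hs, hsA⟩ := hdense a t ht.1 ⟨le_rfl, (ht.1.trans ht.2).le⟩ ⟨ht.1.le, ht.2.le⟩
    obtain ⟨s', hs', hsA'⟩ := hdense t b ht.2 ⟨ht.1.le, ht.2.le⟩ ⟨(ht.1.trans ht.2).le, le_rfl⟩
    have h1 := hmono ⟨hs.1, hs.2.trans ht.2⟩ ht hs.2.le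
    have h2 := hmono ht ⟨ht.1.trans hs'.1, hs'.2⟩ hs'.1.le
    exact abs_le.2 ⟨(abs_le.1 hsA).1.trans h1, h2.trans (abs_le.1 hsA').2⟩
  obtain ⟨g, hg, hgp⟩ := hmono.exists_monotone_extension
    ⟨-A, by rintro _ ⟨t, ht, rfl⟩; exact (abs_le.1 (hbd t ht)).1⟩
    ⟨A, by rintro _ ⟨t, ht, rfl⟩; exact (abs_le.1 (hbd t ht)).2⟩
  -- The extension `g` may exceed `A` outside `Ioo a b`; truncation keeps it monotone and leaves it
  -- unchanged inside.
  have hclip : ∀ t ∈ Ioo a b, max (-A) (min A (g t)) = p t := by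
    intro t ht
    have := abs_le.1 (hbd t ht)
    rw [← hgp ht, min_eq_right this.2, max_eq_right this.1]
  refine ⟨fun t => max (-A) (min A (g t)), fun x y h => by dsimp only; gcongr; exact hg h,
    fun t => abs_le.2 ⟨le_max_left _ _, max_le (by linarith) (min_le_left _ _)⟩, ?_, ?_⟩
  · intro t ht
    dsimp only
    rw [hclip t ht]; exact hpd t ht
  · filter_upwards [hf'] with t h ht
    rw [hclip t ht]; exact heq t (h ht).1

/-- Scaled one-dimensional estimate for two convex functions on an interval. -/
theorem ConvexOn.lintegral_sq_deriv_sub_le {a b A B l : ℝ} (hab : a ≤ b) (hl : 0 < l)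
    (hA : 0 ≤ A) (hB : 0 ≤ B) {f g f' g' : ℝ → ℝ}
    (hf : ConvexOn ℝ (Icc a b) f) (hg : ConvexOn ℝ (Icc a b) g)
    (hfc : ContinuousOn f (Icc a b)) (hgc : ContinuousOn g (Icc a b))
    (hf' : ∀ᵐ t, t ∈ Ioo a b → HasDerivAt f (f' t) t ∧ |f' t| ≤ A)
    (hg' : ∀ᵐ t, t ∈ Ioo a b → HasDerivAt g (g' t) t ∧ |g' t| ≤ B) :
    ∫⁻ t in Ioo a b, ENNReal.ofReal ((f' t - g' t) ^ 2)
      ≤ ENNReal.ofReal (9 * (A + B) ^ 2 * l)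
        + ENNReal.ofReal (6 / l ^ 2) * ∫⁻ t in Ioo a b, ENNReal.ofReal ((f t - g t) ^ 2) := by
  obtain ⟨P, hP, hPA, hPd, hPe⟩ := hf.exists_monotone_rightDeriv hA hf'
  obtain ⟨Q, hQ, hQB, hQd, hQe⟩ := hg.exists_monotone_rightDeriv hB hg'
  have hwc : ContinuousOn (fun t => f t - g t) (Icc a b) := hfc.sub hgc
  have key := integral_sq_sub_monotone_le hab hl hwc
    (fun t ht => (hPd t ht).sub (hQd t ht)) hP hPA hQ hQB
  have h1 : ∫⁻ t in Ioo a b, ENNReal.ofReal ((f' t - g' t) ^ 2)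
      = ∫⁻ t in Ioc a b, ENNReal.ofReal ((P t - Q t) ^ 2) := by
    rw [← setLIntegral_congr (Ioo_ae_eq_Ioc (μ := volume) (a := a) (b := b))]
    apply setLIntegral_congr_fun_ae measurableSet_Ioo
    filter_upwards [hPe, hQe] with t h1 h2 ht
    rw [h1 ht, h2 ht]
  have hi1 : Integrable (fun t => (P t - Q t) ^ 2) (volume.restrict (Ioc a b)) := by
    refine Integrable.of_bound
      ((hP.measurable.sub hQ.measurable).pow_const 2).aestronglyMeasurable ((A + B) ^ 2)
      (ae_of_all _ fun t => ?_)
    rw [norm_pow]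
    gcongr
    exact (abs_sub _ _).trans (add_le_add (hPA t) (hQB t))
  have hi2 : Integrable (fun t => (f t - g t) ^ 2) (volume.restrict (Ioc a b)) :=
    (hwc.pow 2).integrableOn_Icc.mono_set Ioc_subset_Icc_self
  rw [h1, setLIntegral_congr (Ioo_ae_eq_Ioc (μ := volume) (a := a) (b := b)),
    ← ofReal_integral_eq_lintegral_ofReal hi1 (ae_of_all _ fun t => sq_nonneg _),
    ← ofReal_integral_eq_lintegral_ofReal hi2 (ae_of_all _ fun t => sq_nonneg _),
    ← ENNReal.ofReal_mul (by positivity), ← ENNReal.ofReal_add (by positivity)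
      (mul_nonneg (by positivity) (integral_nonneg fun t => sq_nonneg _))]
  exact ENNReal.ofReal_le_ofReal key

end OneDim

/-! ### Bounded open subsets of the line -/

section Line

open Set

/-- The component of `U` ending at `b`, i.e. the points from which `b` is reached from the left
within `U`. -/
def leftComponent (U : Set ℝ) (b : ℝ) : Set ℝ := {t | t < b ∧ Ico t b ⊆ U}

theorem leftComponent_subset (U : Set ℝ) (b : ℝ) : leftComponent U b ⊆ U :=
  fun _ ht => ht.2 ⟨le_rfl, ht.1⟩

theorem ordConnected_leftComponent (U : Set ℝ) (b : ℝ) : (leftComponent U b).OrdConnected :=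
  ⟨fun _ hx _ hy _ hz => ⟨hz.2.trans_lt hy.1, (Ico_subset_Ico_left hz.1).trans hx.2⟩⟩

theorem measurableSet_leftComponent (U : Set ℝ) (b : ℝ) : MeasurableSet (leftComponent U b) :=
  (ordConnected_leftComponent U b).measurableSet

/-- A common point `t < b < c` would give `b ∈ Ico t c ⊆ U`. -/
theorem disjoint_leftComponent {U : Set ℝ} {b c : ℝ} (hb : b ∉ U) (hbc : b < c) :
    Disjoint (leftComponent U b) (leftComponent U c) :=
  disjoint_left.2 fun _ ht ht' => hb (ht'.2 ⟨ht.1.le, hbc⟩)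

theorem exists_leftComponent_ae_eq_Ioo {U : Set ℝ} (hU : Bornology.IsBounded U) {b : ℝ}
    (hne : (leftComponent U b).Nonempty) :
    ∃ a < b, Ioo a b ⊆ U ∧ leftComponent U b =ᵐ[volume] Ioo a b := by
  have hbdd : BddBelow (leftComponent U b) := hU.bddBelow.mono (leftComponent_subset U b)
  have h1 : Ioo (sInf (leftComponent U b)) b ⊆ leftComponent U b := by
    intro t ht
    obtain ⟨s, hs, hst⟩ := exists_lt_of_csInf_lt hne ht.1
    exact ⟨ht.2, (Ico_subset_Ico_left hst.le).trans hs.2⟩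
  have h2 : leftComponent U b ⊆ Ico (sInf (leftComponent U b)) b :=
    fun t ht => ⟨csInf_le hbdd ht, ht.1⟩
  refine ⟨sInf (leftComponent U b), ?_, h1.trans (leftComponent_subset U b),
    Filter.EventuallyLE.antisymm
      (h2.eventuallyLE.trans (Ioo_ae_eq_Ico (μ := volume)).symm.le) h1.eventuallyLE⟩
  obtain ⟨t, ht⟩ := hne
  exact (csInf_le hbdd ht).trans_lt ht.1

/-- Take for `b` the first point outside `U` to the right of `t`. Thus components are indexed by
their right endpoints, which are boundary points. -/
theorem IsOpen.exists_mem_leftComponent {U : Set ℝ} (hUo : IsOpen U) (hU : Bornology.IsBounded U)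
    {t : ℝ} (ht : t ∈ U) : ∃ b ∈ frontier U, t ∈ leftComponent U b := by
  set Z := Ici t ∩ Uᶜ with hZ
  have hZc : IsClosed Z := isClosed_Ici.inter hUo.isClosed_compl
  have hZne : Z.Nonempty := by
    obtain ⟨R, hR⟩ := hU.bddAbove
    refine ⟨max t (R + 1), mem_Ici.2 (le_max_left _ _), fun h => ?_⟩
    have := (le_max_right t (R + 1)).trans (hR h)
    linarith
  have hZb : BddBelow Z := ⟨t, fun s hs => hs.1⟩
  have hmem := hZc.csInf_mem hZne hZb
  set b := sInf Z with hb
  have htb : t < b := lt_of_le_of_ne hmem.1 fun h => hmem.2 (h ▸ ht)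
  have hsub : Ico t b ⊆ U := by
    intro s hs
    by_contra h
    exact absurd (csInf_le hZb (show s ∈ Z from ⟨hs.1, h⟩)) (not_le.2 hs.2)
  refine ⟨b, ⟨?_, ?_⟩, htb, hsub⟩
  · exact closure_mono hsub (by rw [closure_Ico htb.ne]; exact ⟨htb.le, le_rfl⟩)
  · rw [hUo.interior_eq]; exact hmem.2

/-- The one-dimensional estimate on a bounded open set of the line with finite boundary. -/
theorem lintegral_sq_deriv_sub_le_of_frontier_subset {U : Set ℝ} (hUo : IsOpen U)
    (hUb : Bornology.IsBounded U) {T : Finset ℝ} (hT : frontier U ⊆ T) {A B l : ℝ} (hl : 0 < l)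
    (hA : 0 ≤ A) (hB : 0 ≤ B) {f g f' g' : ℝ → ℝ}
    (hf : ∀ a b, a < b → Ioo a b ⊆ U → ConvexOn ℝ (Icc a b) f ∧ ContinuousOn f (Icc a b))
    (hg : ∀ a b, a < b → Ioo a b ⊆ U → ConvexOn ℝ (Icc a b) g ∧ ContinuousOn g (Icc a b))
    (hf' : ∀ᵐ t, t ∈ U → HasDerivAt f (f' t) t ∧ |f' t| ≤ A)
    (hg' : ∀ᵐ t, t ∈ U → HasDerivAt g (g' t) t ∧ |g' t| ≤ B) :
    ∫⁻ t in U, ENNReal.ofReal ((f' t - g' t) ^ 2)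
      ≤ T.card * ENNReal.ofReal (9 * (A + B) ^ 2 * l)
        + ENNReal.ofReal (6 / l ^ 2) * ∫⁻ t in U, ENNReal.ofReal ((f t - g t) ^ 2) := by
  classical
  -- `T` may contain points of `U`; discarding them makes the components disjoint and loses no
  -- frontier point.
  set T' := T.filter (· ∉ U) with hT'
  have hUeq : U = ⋃ b ∈ T', leftComponent U b := by
    apply Subset.antisymm
    · intro t ht
      obtain ⟨b, hb, htb⟩ := hUo.exists_mem_leftComponent hUb ht
      refine mem_biUnion (x := b) ?_ htb
      simp only [hT', Finset.coe_filter, mem_ofPred_eq]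
      exact ⟨hT hb, fun h => hb.2 (by rwa [hUo.interior_eq])⟩
    · exact iUnion₂_subset fun b _ => leftComponent_subset U b
  have hdisj : (T' : Set ℝ).PairwiseDisjoint (leftComponent U) := by
    intro b hb c hc hbc
    have hb' := (Finset.mem_filter.1 hb).2
    have hc' := (Finset.mem_filter.1 hc).2
    rcases lt_or_gt_of_ne hbc with h | h
    · exact disjoint_leftComponent hb' h
    · exact (disjoint_leftComponent hc' h).symm
  have hsum : ∀ h : ℝ → ℝ≥0∞, ∫⁻ t in U, h t = ∑ b ∈ T', ∫⁻ t in leftComponent U b, h t := by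
    intro h
    conv_lhs => rw [hUeq]
    exact lintegral_biUnion_finset hdisj (fun b _ => measurableSet_leftComponent U b) h
  have hJ : ∀ b, ∫⁻ t in leftComponent U b, ENNReal.ofReal ((f' t - g' t) ^ 2)
      ≤ ENNReal.ofReal (9 * (A + B) ^ 2 * l) + ENNReal.ofReal (6 / l ^ 2)
        * ∫⁻ t in leftComponent U b, ENNReal.ofReal ((f t - g t) ^ 2) := by
    intro b
    rcases (leftComponent U b).eq_empty_or_nonempty with he | hne
    · simp [he]
    · obtain ⟨a, hab, hsub, hae⟩ := exists_leftComponent_ae_eq_Ioo hUb hne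
      rw [setLIntegral_congr hae, setLIntegral_congr hae]
      exact (hf a b hab hsub).1.lintegral_sq_deriv_sub_le hab.le hl hA hB (hg a b hab hsub).1
        (hf a b hab hsub).2 (hg a b hab hsub).2 (hf'.mono fun t h ht => h (hsub ht))
        (hg'.mono fun t h ht => h (hsub ht))
  rw [hsum, hsum]
  calc _ ≤ ∑ b ∈ T', (ENNReal.ofReal (9 * (A + B) ^ 2 * l) + ENNReal.ofReal (6 / l ^ 2)
        * ∫⁻ t in leftComponent U b, ENNReal.ofReal ((f t - g t) ^ 2)) :=
        Finset.sum_le_sum fun b _ => hJ b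
    _ = T'.card * ENNReal.ofReal (9 * (A + B) ^ 2 * l) + ENNReal.ofReal (6 / l ^ 2)
        * ∑ b ∈ T', ∫⁻ t in leftComponent U b, ENNReal.ofReal ((f t - g t) ^ 2) := by
        rw [Finset.sum_add_distrib, Finset.sum_const, nsmul_eq_mul, Finset.mul_sum]
    _ ≤ _ := by
        gcongr
        exact Finset.filter_subset _ _

end Line

/-! ### Counting boundary points on parallel lines -/

section Eilenberg

open Set

variable {n : ℕ}

/-- The line in direction `i` through the point with remaining coordinates `y`. -/
def coordLine (i : Fin (n + 1)) (y : Fin n → ℝ) (t : ℝ) : EuclideanSpace ℝ (Fin (n + 1)) :=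
  WithLp.toLp 2 (Fin.insertNth (α := fun _ => ℝ) i t y)

@[simp] theorem coordLine_apply_same (i : Fin (n + 1)) (y : Fin n → ℝ) (t : ℝ) :
    coordLine i y t i = t := by
  simp [coordLine]

@[simp] theorem coordLine_apply_succAbove (i : Fin (n + 1)) (y : Fin n → ℝ) (t : ℝ) (j : Fin n) :
    coordLine i y t (i.succAbove j) = y j := by
  simp [coordLine]

/-- The projection forgetting the coordinate `i`. -/
def forgetCoord (i : Fin (n + 1)) (x : EuclideanSpace ℝ (Fin (n + 1))) : Fin n → ℝ :=
  fun j => x (i.succAbove j)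

theorem lipschitzWith_forgetCoord (i : Fin (n + 1)) : LipschitzWith 1 (forgetCoord i) := by
  apply LipschitzWith.of_dist_le_mul
  intro x y
  rw [NNReal.coe_one, one_mul, dist_pi_le_iff dist_nonneg]
  intro j
  rw [dist_eq_norm, dist_eq_norm]
  exact PiLp.norm_apply_le (x - y) (i.succAbove j)

/-- For the sup metric on `Fin n → ℝ`, `ℋ^n` is exactly Lebesgue measure, so a 1-Lipschitz
projection loses no constant. -/
theorem volume_forgetCoord_image_le (i : Fin (n + 1)) (s : Set (EuclideanSpace ℝ (Fin (n + 1)))) :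
    volume (forgetCoord i '' s) ≤ μH[(n : ℝ)] s := by
  have h := (lipschitzWith_forgetCoord i).hausdorffMeasure_image_le (Nat.cast_nonneg n) s
  have h2 : (μH[(n : ℝ)] : Measure (Fin n → ℝ)) = volume := by
    simpa using hausdorffMeasure_pi_real (ι := Fin n)
  simpa [h2] using h

/-- The Eilenberg inequality for coordinate projections: the number of points of `S` on the lines
in direction `i` has a measurable majorant whose integral is at most `ℋ^n(S)`. -/
theorem exists_measurable_card_le_lintegral_le_hausdorffMeasure (i : Fin (n + 1))
    {S : Set (EuclideanSpace ℝ (Fin (n + 1)))} (hS : MeasurableSet S) :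
    ∃ F : (Fin n → ℝ) → ℝ≥0∞, Measurable F ∧
      (∀ y (T : Finset ℝ), (T : Set ℝ) ⊆ coordLine i y ⁻¹' S → (T.card : ℝ≥0∞) ≤ F y) ∧
      ∫⁻ y, F y ≤ μH[(n : ℝ)] S := by
  classical
  let slab : ℕ → ℤ → Set (EuclideanSpace ℝ (Fin (n + 1))) := fun k m => {x | ⌊x i * k⌋ = m}
  have hslab : ∀ k m, MeasurableSet (slab k m) := by
    intro k m
    have h : Measurable fun x : EuclideanSpace ℝ (Fin (n + 1)) => ⌊x i * k⌋ := by
      apply Measurable.floor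
      have : Continuous fun x : EuclideanSpace ℝ (Fin (n + 1)) => x i * k := by fun_prop
      exact this.measurable
    exact h (measurableSet_singleton m)
  -- Measurable hulls replace the projections, whose measurability is not needed. `f k y` bounds the
  -- number of slabs of width `1/k` in which the line over `y` meets `S`.
  let E : ℕ → ℤ → Set (Fin n → ℝ) := fun k m =>
    toMeasurable volume (forgetCoord i '' (S ∩ slab k m))
  let f : ℕ → (Fin n → ℝ) → ℝ≥0∞ := fun k y => ∑' m, (E k m).indicator 1 y
  have hEm : ∀ k m, Measurable ((E k m).indicator (1 : (Fin n → ℝ) → ℝ≥0∞)) := fun k m =>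
    measurable_one.indicator (measurableSet_toMeasurable _ _)
  have hfm : ∀ k, Measurable (f k) := fun k => Measurable.tsum (hEm k)
  have hfi : ∀ k, ∫⁻ y, f k y ≤ μH[(n : ℝ)] S := by
    intro k
    calc ∫⁻ y, f k y = ∑' m, volume (forgetCoord i '' (S ∩ slab k m)) := by
          simp only [f]
          rw [lintegral_tsum fun m => (hEm k m).aemeasurable]
          congr 1; ext m
          rw [lintegral_indicator_one (measurableSet_toMeasurable _ _), measure_toMeasurable]
      _ ≤ ∑' m, μH[(n : ℝ)] (S ∩ slab k m) :=
          ENNReal.tsum_le_tsum fun m => volume_forgetCoord_image_le i _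
      _ = μH[(n : ℝ)] (⋃ m, S ∩ slab k m) := by
          rw [measure_iUnion _ fun m => hS.inter (hslab k m)]
          intro m m' hmm
          refine disjoint_left.2 fun x hx hx' => hmm ?_
          exact (show ⌊x i * k⌋ = m from hx.2).symm.trans hx'.2
      _ ≤ μH[(n : ℝ)] S := measure_mono (iUnion_subset fun m => inter_subset_left)
  refine ⟨fun y => Filter.liminf (fun k => f k y) Filter.atTop, Measurable.liminf hfm, ?_, ?_⟩
  · intro y T hT
    refine Filter.le_liminf_of_le (by isBoundedDefault) ?_
    -- For large `k` the finitely many points of `T` lie in distinct slabs, so `f k y` is at least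
    -- their number. Fatou then bounds the integral of the liminf.
    have hsep : ∀ᶠ k : ℕ in Filter.atTop, ∀ s ∈ T, ∀ t ∈ T, s < t → 1 ≤ (t - s) * k := by
      refine (Filter.eventually_all_finset T).2 fun s _ =>
        (Filter.eventually_all_finset T).2 fun t _ => ?_
      by_cases hst : s < t
      · have : Filter.Tendsto (fun k : ℕ => (t - s) * (k : ℝ)) Filter.atTop Filter.atTop :=
          tendsto_natCast_atTop_atTop.const_mul_atTop (sub_pos.2 hst)
        filter_upwards [this.eventually_ge_atTop 1] with k hk _ using hk
      · exact Filter.Eventually.of_forall fun k h => absurd h hst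
    filter_upwards [hsep] with k hk
    have hlt : ∀ s ∈ T, ∀ t ∈ T, s < t → ⌊s * k⌋ ≠ ⌊t * k⌋ := by
      intro s hs t ht hst h
      have h1 := hk s hs t ht hst
      have h2 := Int.floor_le (s * k)
      have h3 := Int.lt_floor_add_one (t * (k : ℝ))
      rw [← h] at h3
      linarith
    have hinj : Set.InjOn (fun t : ℝ => ⌊t * k⌋) T := by
      intro s hs t ht h
      rcases lt_trichotomy s t with h' | h' | h'
      · exact absurd h (hlt s hs t ht h')
      · exact h'
      · exact absurd h.symm (hlt t ht s hs h')
    calc (T.card : ℝ≥0∞) = ∑ m ∈ T.image (fun t : ℝ => ⌊t * k⌋), 1 := by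
          rw [Finset.sum_const, Finset.card_image_of_injOn hinj, nsmul_eq_mul, mul_one]
      _ ≤ ∑ m ∈ T.image (fun t : ℝ => ⌊t * k⌋), (E k m).indicator 1 y := by
          apply Finset.sum_le_sum
          intro m hm
          obtain ⟨t, ht, rfl⟩ := Finset.mem_image.1 hm
          have : y ∈ E k ⌊t * k⌋ := by
            apply subset_toMeasurable
            refine ⟨coordLine i y t, ⟨hT ht, ?_⟩, ?_⟩
            · simp [slab]
            · ext j; simp [forgetCoord]
          rw [indicator_of_mem this]; rfl
      _ ≤ f k y := ENNReal.sum_le_tsum _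
  · calc _ ≤ Filter.liminf (fun k => ∫⁻ y, f k y) Filter.atTop := lintegral_liminf_le hfm
      _ ≤ Filter.liminf (fun _ : ℕ => μH[(n : ℝ)] S) Filter.atTop :=
          Filter.liminf_le_liminf (Filter.Eventually.of_forall hfi)
      _ = _ := Filter.liminf_const _

end Eilenberg

/-! ### Slicing along a coordinate direction -/

section Slicing

open Set

variable {n : ℕ}

theorem measurePreserving_coordLine (i : Fin (n + 1)) :
    MeasurePreserving (fun z : (Fin n → ℝ) × ℝ => coordLine i z.1 z.2) volume volume :=
  (PiLp.volume_preserving_toLp (Fin (n + 1))).comp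
    ((volume_preserving_piFinSuccAbove (fun _ => ℝ) i).symm.comp Measure.measurePreserving_swap)

theorem ae_ae_coordLine (i : Fin (n + 1)) {p : EuclideanSpace ℝ (Fin (n + 1)) → Prop}
    (h : ∀ᵐ x, p x) : ∀ᵐ y : Fin n → ℝ, ∀ᵐ t : ℝ, p (coordLine i y t) :=
  Measure.ae_ae_of_ae_prod ((measurePreserving_coordLine i).quasiMeasurePreserving.ae h)

theorem coordLine_eq (i : Fin (n + 1)) (y : Fin n → ℝ) (t : ℝ) :
    coordLine i y t = coordLine i y 0 + t • EuclideanSpace.single i (1 : ℝ) := by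
  ext j
  rcases Fin.eq_self_or_eq_succAbove i j with rfl | ⟨k, rfl⟩
  · simp
  · simp

theorem lineMap_eq_coordLine (i : Fin (n + 1)) (y : Fin n → ℝ) :
    ⇑(AffineMap.lineMap (k := ℝ) (coordLine i y 0) (coordLine i y 1)) = coordLine i y := by
  ext1 t
  rw [AffineMap.lineMap_apply, coordLine_eq i y 1, coordLine_eq i y t]
  simp [add_comm]

theorem hasDerivAt_coordLine (i : Fin (n + 1)) (y : Fin n → ℝ) (t : ℝ) :
    HasDerivAt (coordLine i y) (EuclideanSpace.single i (1 : ℝ)) t := by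
  have h : coordLine i y = fun t => coordLine i y 0 + t • EuclideanSpace.single i (1 : ℝ) :=
    funext (coordLine_eq i y)
  rw [h]
  simpa using ((hasDerivAt_id t).smul_const (EuclideanSpace.single i (1 : ℝ))).const_add
    (coordLine i y 0)

theorem continuous_coordLine (i : Fin (n + 1)) (y : Fin n → ℝ) : Continuous (coordLine i y) :=
  continuous_iff_continuousAt.2 fun t => (hasDerivAt_coordLine i y t).continuousAt

theorem coordLine_image_Icc (i : Fin (n + 1)) (y : Fin n → ℝ) {a b : ℝ} (hab : a ≤ b) :
    coordLine i y '' Icc a b = segment ℝ (coordLine i y a) (coordLine i y b) := by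
  rw [← segment_eq_Icc hab, ← lineMap_eq_coordLine, image_segment]

theorem ConvexOnSegments.comp_coordLine {K : Set (EuclideanSpace ℝ (Fin (n + 1)))}
    {u : EuclideanSpace ℝ (Fin (n + 1)) → ℝ} (hu : ConvexOnSegments K u) (i : Fin (n + 1))
    (y : Fin n → ℝ) {a b : ℝ} (hab : a ≤ b) (hK : Icc a b ⊆ coordLine i y ⁻¹' K) :
    ConvexOn ℝ (Icc a b) fun t => u (coordLine i y t) := by
  have him := coordLine_image_Icc i y hab
  have h := (hu _ _ (him ▸ image_subset_iff.2 hK)).comp_affineMap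
    (AffineMap.lineMap (k := ℝ) (coordLine i y 0) (coordLine i y 1))
  rw [lineMap_eq_coordLine, ← him] at h
  exact h.subset (subset_preimage_image _ _) (convex_Icc a b)

theorem hasDerivAt_comp_coordLine {u : EuclideanSpace ℝ (Fin (n + 1)) → ℝ} (i : Fin (n + 1))
    (y : Fin n → ℝ) {t : ℝ} (h : DifferentiableAt ℝ u (coordLine i y t)) :
    HasDerivAt (fun s => u (coordLine i y s)) (gradient u (coordLine i y t) i) t := by
  have h1 := h.hasFDerivAt.comp_hasDerivAt t (hasDerivAt_coordLine i y t)
  have h2 : fderiv ℝ u (coordLine i y t) (EuclideanSpace.single i (1 : ℝ))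
      = gradient u (coordLine i y t) i := by
    rw [← toDual_gradient, InnerProductSpace.toDual_apply_apply,
      EuclideanSpace.inner_single_right]
    simp
  rwa [h2] at h1

theorem setLIntegral_eq_lintegral_coordLine (i : Fin (n + 1))
    {U : Set (EuclideanSpace ℝ (Fin (n + 1)))} (hU : IsOpen U)
    {h : EuclideanSpace ℝ (Fin (n + 1)) → ℝ≥0∞} (hh : AEMeasurable h (volume.restrict U)) :
    ∫⁻ x in U, h x = ∫⁻ y, ∫⁻ t in coordLine i y ⁻¹' U, h (coordLine i y t) := by
  have hI : AEMeasurable (U.indicator h) volume := (aemeasurable_indicator_iff hU.measurableSet).2 hh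
  have hmp := measurePreserving_coordLine i
  rw [← lintegral_indicator hU.measurableSet]
  rw [← hmp.map_eq, lintegral_map' (hmp.map_eq.symm ▸ hI) hmp.measurable.aemeasurable]
  rw [Measure.volume_eq_prod, lintegral_prod]
  · congr 1; ext y
    rw [← lintegral_indicator ((hU.preimage (continuous_coordLine i y)).measurableSet)]
    rfl
  · exact hI.comp_quasiMeasurePreserving hmp.quasiMeasurePreserving

theorem measurable_gradient (u : EuclideanSpace ℝ (Fin (n + 1)) → ℝ) : Measurable (gradient u) :=
  ((InnerProductSpace.toDual ℝ (EuclideanSpace ℝ (Fin (n + 1)))).symm.continuous.measurable).comp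
    (measurable_fderiv ℝ u)

/-- Scaled estimate for one partial derivative, obtained by slicing. -/
theorem lintegral_sq_partial_sub_le (i : Fin (n + 1))
    {K : Set (EuclideanSpace ℝ (Fin (n + 1)))} (hK : IsCompact K)
    {u v : EuclideanSpace ℝ (Fin (n + 1)) → ℝ} (huc : ContinuousOn u K) (hvc : ContinuousOn v K)
    (hu : ConvexOnSegments K u) (hv : ConvexOnSegments K v) {A B l : ℝ} (hl : 0 < l)
    (hA : 0 ≤ A) (hB : 0 ≤ B) (hAB : 0 < A + B)
    (hud : ∀ᵐ x, x ∈ interior K → DifferentiableAt ℝ u x ∧ ‖gradient u x‖ ≤ A)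
    (hvd : ∀ᵐ x, x ∈ interior K → DifferentiableAt ℝ v x ∧ ‖gradient v x‖ ≤ B) :
    ∫⁻ x in interior K, ENNReal.ofReal ((gradient u x i - gradient v x i) ^ 2)
      ≤ ENNReal.ofReal (9 * (A + B) ^ 2 * l) * μH[(n : ℝ)] (frontier K)
        + ENNReal.ofReal (6 / l ^ 2) * ∫⁻ x in interior K, ENNReal.ofReal ((u x - v x) ^ 2) := by
  have hUo : IsOpen (interior K) := isOpen_interior
  obtain ⟨F, hFm, hFc, hFi⟩ := exists_measurable_card_le_lintegral_le_hausdorffMeasure i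
    (S := frontier K) isClosed_frontier.measurableSet
  have hgm : ∀ w : EuclideanSpace ℝ (Fin (n + 1)) → ℝ, Measurable fun x => gradient w x i := by
    intro w
    have h : Continuous fun x : EuclideanSpace ℝ (Fin (n + 1)) => x i := by fun_prop
    exact h.measurable.comp (measurable_gradient w)
  have hm1 : AEMeasurable (fun x => ENNReal.ofReal ((gradient u x i - gradient v x i) ^ 2))
      (volume.restrict (interior K)) :=
    (((hgm u).sub (hgm v)).pow_const 2).ennreal_ofReal.aemeasurable
  have hm2 : AEMeasurable (fun x => ENNReal.ofReal ((u x - v x) ^ 2))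
      (volume.restrict (interior K)) := by
    have h : ContinuousOn (fun x => (u x - v x) ^ 2) (interior K) :=
      ((huc.sub hvc).pow 2).mono interior_subset
    exact (h.aemeasurable hUo.measurableSet).ennreal_ofReal
  rw [setLIntegral_eq_lintegral_coordLine i hUo hm1, setLIntegral_eq_lintegral_coordLine i hUo hm2]
  have hline : ∀ᵐ y : Fin n → ℝ,
      ∫⁻ t in coordLine i y ⁻¹' interior K, ENNReal.ofReal
        ((gradient u (coordLine i y t) i - gradient v (coordLine i y t) i) ^ 2)
      ≤ ENNReal.ofReal (9 * (A + B) ^ 2 * l) * F y + ENNReal.ofReal (6 / l ^ 2)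
        * ∫⁻ t in coordLine i y ⁻¹' interior K,
            ENNReal.ofReal ((u (coordLine i y t) - v (coordLine i y t)) ^ 2) := by
    filter_upwards [ae_ae_coordLine i hud, ae_ae_coordLine i hvd] with y hyu hyv
    have hc := continuous_coordLine i y
    have hfr : frontier (coordLine i y ⁻¹' interior K) ⊆ coordLine i y ⁻¹' frontier K :=
      (hc.frontier_preimage_subset _).trans (preimage_mono frontier_interior_subset)
    rcases (frontier (coordLine i y ⁻¹' interior K)).finite_or_infinite with hfin | hinf
    -- `K` is closed, so endpoints may be added: convexity is available on the whole closed segment.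
    · have hseg : ∀ a b, a < b → Ioo a b ⊆ coordLine i y ⁻¹' interior K →
          Icc a b ⊆ coordLine i y ⁻¹' K := by
        intro a b hab hsub
        rw [← closure_Ioo hab.ne]
        exact closure_minimal (hsub.trans (preimage_mono interior_subset))
          (hK.isClosed.preimage hc)
      have hbdd : Bornology.IsBounded (coordLine i y ⁻¹' interior K) := by
        obtain ⟨R, hR⟩ := hK.isBounded.exists_norm_le
        refine (Metric.isBounded_Icc (-R) R).subset fun t ht => ?_
        have h1 := (PiLp.norm_apply_le (coordLine i y t) i).trans (hR _ (interior_subset ht))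
        rw [coordLine_apply_same] at h1
        exact abs_le.1 h1
      have hder : ∀ {w : EuclideanSpace ℝ (Fin (n + 1)) → ℝ} {D : ℝ},
          (∀ᵐ t, coordLine i y t ∈ interior K →
            DifferentiableAt ℝ w (coordLine i y t) ∧ ‖gradient w (coordLine i y t)‖ ≤ D) →
          ∀ᵐ t, t ∈ coordLine i y ⁻¹' interior K →
            HasDerivAt (fun s => w (coordLine i y s)) (gradient w (coordLine i y t) i) t ∧
              |gradient w (coordLine i y t) i| ≤ D := by
        intro w D h
        filter_upwards [h] with t ht htU
        exact ⟨hasDerivAt_comp_coordLine i y (ht htU).1,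
          (PiLp.norm_apply_le (gradient w (coordLine i y t)) i).trans (ht htU).2⟩
      have hcc : ∀ {w : EuclideanSpace ℝ (Fin (n + 1)) → ℝ}, ConvexOnSegments K w →
          ContinuousOn w K → ∀ a b, a < b → Ioo a b ⊆ coordLine i y ⁻¹' interior K →
          ConvexOn ℝ (Icc a b) (fun t => w (coordLine i y t)) ∧
            ContinuousOn (fun t => w (coordLine i y t)) (Icc a b) := fun hw hwc a b hab hsub =>
        ⟨hw.comp_coordLine i y hab.le (hseg a b hab hsub),
          hwc.comp hc.continuousOn (hseg a b hab hsub)⟩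
      refine (lintegral_sq_deriv_sub_le_of_frontier_subset (hUo.preimage hc) hbdd
        (T := hfin.toFinset) (by simp) hl hA hB (hcc hu huc) (hcc hv hvc) (hder hyu)
        (hder hyv)).trans ?_
      rw [mul_comm (ENNReal.ofReal (9 * (A + B) ^ 2 * l))]
      gcongr
      exact hFc y _ (by simpa using hfr)
    -- Infinitely many boundary points force `F y = ∞`; its coefficient is positive because `A + B >
    -- 0`, so the bound is trivial.
    · have hF : F y = ∞ := by
        refine ENNReal.eq_top_of_forall_nnreal_le fun r => ?_
        obtain ⟨k, hk⟩ := exists_nat_ge r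
        obtain ⟨T, hT, hTk⟩ := hinf.exists_subset_card_eq k
        calc (r : ℝ≥0∞) ≤ (k : ℝ≥0∞) := by exact_mod_cast hk
          _ = (T.card : ℝ≥0∞) := by rw [hTk]
          _ ≤ F y := hFc y T (hT.trans hfr)
      rw [hF, ENNReal.mul_top (by simpa using by positivity), top_add]
      exact le_top
  refine (lintegral_mono_ae hline).trans ?_
  rw [lintegral_add_left (hFm.const_mul _), lintegral_const_mul _ hFm,
    lintegral_const_mul' _ _ ENNReal.ofReal_ne_top]
  gcongr

end Slicing

/-! ### Rectifiable boundaries are Lebesgue null -/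

section Frontier

open Set

variable {n : ℕ}

theorem volume_le_hausdorffMeasure (s : Set (EuclideanSpace ℝ (Fin n))) :
    volume s ≤ μH[(n : ℝ)] s := by
  have h1 : LipschitzWith 1 (WithLp.ofLp : EuclideanSpace ℝ (Fin n) → Fin n → ℝ) :=
    PiLp.lipschitzWith_ofLp 2 _
  have h2 := h1.hausdorffMeasure_image_le (Nat.cast_nonneg n) s
  have h3 : (μH[(n : ℝ)] : Measure (Fin n → ℝ)) = volume := by
    simpa using hausdorffMeasure_pi_real (ι := Fin n)
  have h4 := (PiLp.volume_preserving_ofLp (Fin n)).measure_preimage_equiv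
    (f := MeasurableEquiv.toLp 2 (Fin n → ℝ) |>.symm) (WithLp.ofLp '' s)
  have h5 : volume s ≤ volume (WithLp.ofLp '' s) := by
    refine le_trans (measure_mono ?_) h4.le
    exact subset_preimage_image _ _
  rw [ENNReal.coe_one, ENNReal.one_rpow, one_mul, h3] at h2
  exact h5.trans h2

/-- An `ℋ^n`-rectifiable set of `ℝ^(n+1)` is Lebesgue negligible. -/
theorem IsHausdorffRectifiable.volume_eq_zero {S : Set (EuclideanSpace ℝ (Fin (n + 1)))}
    (hS : IsHausdorffRectifiable n S) : volume S = 0 := by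
  obtain ⟨f, hf, h0⟩ := hS
  -- A Lipschitz image of `ℝ^n` has Hausdorff dimension at most `n < n + 1`.
  have hrange : ∀ k, μH[((n + 1 : ℕ) : ℝ)] (range (f k)) = 0 := by
    intro k
    obtain ⟨L, hL⟩ := hf k
    have h1 : dimH (range (f k)) < ((n + 1 : ℕ) : ℝ≥0) := by
      refine hL.dimH_range_le.trans_lt ?_
      rw [Real.dimH_univ_eq_finrank, finrank_euclideanSpace_fin]
      exact_mod_cast Nat.lt_succ_self n
    exact_mod_cast hausdorffMeasure_of_dimH_lt h1
  have hrest : μH[((n + 1 : ℕ) : ℝ)] (S \ ⋃ k, range (f k)) = 0 := by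
    rcases Measure.hausdorffMeasure_zero_or_top (d₁ := (n : ℝ)) (d₂ := ((n + 1 : ℕ) : ℝ))
      (by push_cast; linarith) (S \ ⋃ k, range (f k)) with h | h
    · exact h
    · rw [h0] at h; exact absurd h (by simp)
  refine le_antisymm ((volume_le_hausdorffMeasure S).trans ?_) zero_le
  calc _ ≤ μH[((n + 1 : ℕ) : ℝ)] ((S \ ⋃ k, range (f k)) ∪ ⋃ k, range (f k)) :=
        measure_mono (by rw [sdiff_union_self]; exact subset_union_left)
    _ ≤ _ := measure_union_le _ _
    _ = 0 := by rw [hrest, measure_iUnion_null hrange, add_zero]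

end Frontier

/-! ### Choice of the scale -/

section Optimise

/-- Optimisation over the scale `l`. -/
theorem le_rpow_of_forall_scale_le {X H W : ℝ≥0∞} {N M : ℝ} (hN : 0 ≤ N) (hM : 0 < M)
    (hH : H ≠ ∞) (hW : W ≠ ∞) (hW0 : W ≠ 0)
    (h : ∀ l : ℝ, 0 < l → X ≤ ENNReal.ofReal N * (ENNReal.ofReal (9 * M ^ 2 * l) * H
      + ENNReal.ofReal (6 / l ^ 2) * W ^ 2)) :
    X ≤ ENNReal.ofReal (15 * N) * H ^ (2 / 3 : ℝ) * ENNReal.ofReal M ^ (4 / 3 : ℝ)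
      * W ^ (2 / 3 : ℝ) := by
  lift H to ℝ≥0 using hH
  lift W to ℝ≥0 using hW
  have hW0' : 0 < (W : ℝ) := by
    have : W ≠ 0 := by simpa using hW0
    exact_mod_cast pos_iff_ne_zero.2 this
  have h' : ∀ l : ℝ, 0 < l → X ≤ ENNReal.ofReal (N * (9 * M ^ 2 * l * H + 6 / l ^ 2 * W ^ 2)) := by
    intro l hl
    refine (h l hl).trans (le_of_eq ?_)
    rw [ENNReal.ofReal_mul hN, ENNReal.ofReal_add (by positivity) (by positivity),
      ENNReal.ofReal_mul (p := 9 * M ^ 2 * l) (by positivity),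
      ENNReal.ofReal_mul (p := 6 / l ^ 2) (by positivity), ENNReal.ofReal_pow W.coe_nonneg,
      ENNReal.ofReal_coe_nnreal, ENNReal.ofReal_coe_nnreal]
  rcases eq_or_ne H 0 with rfl | hH0
  -- With `H = 0` no finite scale is optimal: let `l → ∞`.
  · have hX : X ≤ 0 := by
      have ht : Filter.Tendsto (fun l : ℝ => ENNReal.ofReal (N * (6 / l ^ 2 * W ^ 2))) Filter.atTop
          (nhds 0) := by
        have h1 : Filter.Tendsto (fun l : ℝ => 6 / l ^ 2) Filter.atTop (nhds 0) :=
          tendsto_const_nhds.div_atTop (Filter.tendsto_pow_atTop two_ne_zero)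
        have h2 := (h1.mul_const ((W : ℝ) ^ 2)).const_mul N
        simp only [zero_mul, mul_zero] at h2
        simpa using ENNReal.tendsto_ofReal h2
      refine ge_of_tendsto ht ?_
      filter_upwards [Filter.eventually_gt_atTop 0] with l hl
      simpa using h' l hl
    exact hX.trans zero_le
  · have hHpos : 0 < (H : ℝ) := by exact_mod_cast pos_iff_ne_zero.2 hH0
    set a := (W : ℝ) ^ (1 / 3 : ℝ) with ha
    set b := M ^ (1 / 3 : ℝ) with hb
    set c := (H : ℝ) ^ (1 / 3 : ℝ) with hc
    have ha0 : 0 < a := by positivity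
    have hb0 : 0 < b := by positivity
    have hc0 : 0 < c := by positivity
    have hcube : ∀ {x : ℝ}, 0 < x → (x ^ (1 / 3 : ℝ)) ^ 3 = x := by
      intro x hx
      rw [← Real.rpow_natCast, ← Real.rpow_mul hx.le]; norm_num
    have hW3 : (W : ℝ) = a ^ 3 := (hcube hW0').symm
    have hM3 : M = b ^ 3 := (hcube hM).symm
    have hH3 : (H : ℝ) = c ^ 3 := (hcube hHpos).symm
    have e1 : (H : ℝ) ^ (2 / 3 : ℝ) = c ^ 2 := by
      rw [hc, ← Real.rpow_natCast, ← Real.rpow_mul hHpos.le]; norm_num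
    have e2 : M ^ (4 / 3 : ℝ) = b ^ 4 := by
      rw [hb, ← Real.rpow_natCast, ← Real.rpow_mul hM.le]; norm_num
    have e3 : (W : ℝ) ^ (2 / 3 : ℝ) = a ^ 2 := by
      rw [ha, ← Real.rpow_natCast, ← Real.rpow_mul hW0'.le]; norm_num
    -- This is `l³ = W² / (M² H)`: the two terms become `9` and `6` times `a² b⁴ c²`, hence the
    -- factor `15`.
    refine (h' (a ^ 2 / (b ^ 2 * c)) (by positivity)).trans (le_of_eq ?_)
    rw [← ENNReal.ofReal_coe_nnreal (p := H), ← ENNReal.ofReal_coe_nnreal (p := W),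
      ENNReal.ofReal_rpow_of_pos hHpos, ENNReal.ofReal_rpow_of_pos hM,
      ENNReal.ofReal_rpow_of_pos hW0', e1, e2, e3, ← ENNReal.ofReal_mul (by positivity),
      ← ENNReal.ofReal_mul (by positivity), ← ENNReal.ofReal_mul (by positivity), hW3, hM3, hH3]
    congr 1
    field_simp
    ring

end Optimise

/-! ### Assembling the estimate -/

section Main

open Set

variable {n : ℕ}

theorem gradientWithin_of_mem_interior {K : Set (EuclideanSpace ℝ (Fin n))}
    {u : EuclideanSpace ℝ (Fin n) → ℝ} {x : EuclideanSpace ℝ (Fin n)} (hx : x ∈ interior K) :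
    gradientWithin u K x = gradient u x := by
  rw [gradientWithin, gradient, fderivWithin_of_mem_nhds (mem_interior_iff_mem_nhds.1 hx)]

theorem LipschitzOnWith.norm_gradient_le {K : Set (EuclideanSpace ℝ (Fin n))} {L : ℝ≥0}
    {u : EuclideanSpace ℝ (Fin n) → ℝ} (hu : LipschitzOnWith L u K)
    {x : EuclideanSpace ℝ (Fin n)} (hx : x ∈ interior K) : ‖gradient u x‖ ≤ L := by
  rw [gradient, LinearIsometryEquiv.norm_map]
  exact norm_fderiv_le_of_lipschitzOn ℝ (mem_interior_iff_mem_nhds.1 hx) hu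

theorem LipschitzOnWith.ae_differentiableAt_interior {K : Set (EuclideanSpace ℝ (Fin n))}
    {L : ℝ≥0} {u : EuclideanSpace ℝ (Fin n) → ℝ} (hu : LipschitzOnWith L u K) :
    ∀ᵐ x, x ∈ interior K → DifferentiableAt ℝ u x := by
  have h := (hu.mono interior_subset).ae_differentiableWithinAt (μ := volume)
    isOpen_interior.measurableSet
  rw [ae_restrict_iff' isOpen_interior.measurableSet] at h
  filter_upwards [h] with x hx hxK
  exact (hx hxK).differentiableAt (isOpen_interior.mem_nhds hxK)

theorem eLpNorm_two_sq_eq_lintegral {α E : Type*} [MeasurableSpace α] [NormedAddCommGroup E]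
    (μ : Measure α) (f : α → E) :
    eLpNorm f 2 μ ^ 2 = ∫⁻ x, ENNReal.ofReal (‖f x‖ ^ 2) ∂μ := by
  have h := eLpNorm_nnreal_pow_eq_lintegral (μ := μ) (f := f) (p := 2) two_ne_zero
  have h2 : eLpNorm f 2 μ ^ 2 = ∫⁻ x, ‖f x‖ₑ ^ 2 ∂μ := by
    simpa using h
  rw [h2]
  congr 1; ext x
  rw [← ofReal_norm, ENNReal.ofReal_pow (norm_nonneg _)]

/-- If two functions continuous on an open set agree a.e. there, so do their gradients. -/
theorem gradient_eq_of_ae_eq_of_isOpen {U : Set (EuclideanSpace ℝ (Fin n))} (hU : IsOpen U)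
    {u v : EuclideanSpace ℝ (Fin n) → ℝ} (hu : ContinuousOn u U) (hv : ContinuousOn v U)
    (h : u =ᵐ[volume.restrict U] v) {x : EuclideanSpace ℝ (Fin n)} (hx : x ∈ U) :
    gradient u x = gradient v x := by
  have heq : EqOn u v U := Measure.eqOn_open_of_ae_eq h hU hu hv
  have h1 : u =ᶠ[nhds x] v := Filter.eventuallyEq_of_mem (hU.mem_nhds hx) heq
  rw [gradient, gradient, h1.fderiv_eq]

theorem ae_norm_le_toReal_eLpNorm_top {α E : Type*} [MeasurableSpace α] [NormedAddCommGroup E]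
    {μ : Measure α} {f : α → E} (h : eLpNorm f ∞ μ ≠ ∞) :
    ∀ᵐ x ∂μ, ‖f x‖ ≤ (eLpNorm f ∞ μ).toReal := by
  rw [eLpNorm_exponent_top] at h ⊢
  filter_upwards [ae_le_eLpNormEssSup (f := f) (μ := μ)] with x hx
  rw [← toReal_enorm]
  exact ENNReal.toReal_mono h hx

/-- The stability estimate on the interior of a compact set. -/
theorem eLpNorm_gradient_sub_sq_le {K : Set (EuclideanSpace ℝ (Fin (n + 1)))} (hK : IsCompact K)
    {u v : EuclideanSpace ℝ (Fin (n + 1)) → ℝ} {L L' : ℝ≥0} (hu : LipschitzOnWith L u K)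
    (hv : LipschitzOnWith L' v K) (hcu : ConvexOnSegments K u) (hcv : ConvexOnSegments K v) :
    eLpNorm (fun x => gradient u x - gradient v x) 2 (volume.restrict (interior K)) ^ 2
      ≤ ENNReal.ofReal (15 * (n + 1)) * μH[(n : ℝ)] (frontier K) ^ (2 / 3 : ℝ)
        * (eLpNorm (gradient u) ∞ (volume.restrict (interior K))
          + eLpNorm (gradient v) ∞ (volume.restrict (interior K))) ^ (4 / 3 : ℝ)
        * eLpNorm (fun x => u x - v x) 2 (volume.restrict (interior K)) ^ (2 / 3 : ℝ) := by
  have hUm : MeasurableSet (interior K) := isOpen_interior.measurableSet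
  set μ := volume.restrict (interior K) with hμ
  set A := eLpNorm (gradient u) ∞ μ with hAdef
  set B := eLpNorm (gradient v) ∞ μ with hBdef
  set W := eLpNorm (fun x => u x - v x) 2 μ with hWdef
  have hfin : ∀ {w : EuclideanSpace ℝ (Fin (n + 1)) → ℝ} {D : ℝ≥0}, LipschitzOnWith D w K →
      eLpNorm (gradient w) ∞ μ ≠ ∞ := by
    intro w D hw
    refine (eLpNormEssSup_lt_top_of_ae_bound (C := D) ?_).ne
    exact ae_restrict_of_forall_mem hUm fun x hx => hw.norm_gradient_le hx
  have hA : A ≠ ∞ := hfin hu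
  have hB : B ≠ ∞ := hfin hv
  have hgrad : ∀ {w : EuclideanSpace ℝ (Fin (n + 1)) → ℝ} {D : ℝ≥0}, LipschitzOnWith D w K →
      ∀ᵐ x, x ∈ interior K →
        DifferentiableAt ℝ w x ∧ ‖gradient w x‖ ≤ (eLpNorm (gradient w) ∞ μ).toReal := by
    intro w D hw
    filter_upwards [hw.ae_differentiableAt_interior,
      (ae_restrict_iff' hUm).1 (ae_norm_le_toReal_eLpNorm_top (hfin hw))] with x h1 h2 hx
    exact ⟨h1 hx, h2 hx⟩
  have hwc : ContinuousOn (fun x => u x - v x) K := hu.continuousOn.sub hv.continuousOn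
  have hW : W ≠ ∞ := by
    obtain ⟨R, hR⟩ := hK.exists_bound_of_continuousOn hwc
    have hfm : IsFiniteMeasure μ :=
      ⟨by
        rw [hμ, Measure.restrict_apply_univ]
        exact (measure_mono interior_subset).trans_lt hK.measure_lt_top⟩
    refine (MemLp.of_bound
      ((hwc.mono interior_subset).aestronglyMeasurable hUm) R ?_).eLpNorm_ne_top
    exact ae_restrict_of_forall_mem hUm fun x hx => hR x (interior_subset hx)
  have hzero : (∀ᵐ x ∂μ, gradient u x = gradient v x) →
      eLpNorm (fun x => gradient u x - gradient v x) 2 μ ^ 2 = 0 := by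
    intro h
    have h0 : (fun x => gradient u x - gradient v x) =ᵐ[μ] 0 := by
      filter_upwards [h] with x hx
      simp [hx]
    rw [eLpNorm_congr_ae h0, eLpNorm_zero]
    simp
  -- If `A + B = 0` or `W = 0`, the gradients agree a.e. and the left side vanishes, which also
  -- settles the `0 * ∞` cases. Otherwise `H = ∞` makes the right side infinite.
  rcases eq_or_ne (A + B) 0 with hAB | hAB
  · obtain ⟨hA0, hB0⟩ := add_eq_zero.1 hAB
    rw [hzero ?_]
    · exact zero_le
    · filter_upwards [ae_norm_le_toReal_eLpNorm_top hA, ae_norm_le_toReal_eLpNorm_top hB]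
        with x hx hx'
      rw [← hAdef, hA0, ENNReal.toReal_zero, norm_le_zero_iff] at hx
      rw [← hBdef, hB0, ENNReal.toReal_zero, norm_le_zero_iff] at hx'
      rw [hx, hx']
  rcases eq_or_ne W 0 with hW0 | hW0
  · rw [hzero ?_]
    · exact zero_le
    · have h0 := (eLpNorm_eq_zero_iff ((hwc.mono interior_subset).aestronglyMeasurable hUm)
        two_ne_zero).1 hW0
      have h1 : u =ᵐ[μ] v := by
        filter_upwards [h0] with x hx
        exact sub_eq_zero.1 hx
      exact ae_restrict_of_forall_mem hUm fun x hx =>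
        gradient_eq_of_ae_eq_of_isOpen isOpen_interior (hu.continuousOn.mono interior_subset)
          (hv.continuousOn.mono interior_subset) h1 hx
  have hABtop : A + B ≠ ∞ := ENNReal.add_ne_top.2 ⟨hA, hB⟩
  rcases eq_or_ne (μH[(n : ℝ)] (frontier K)) ∞ with hH | hH
  · have hC : ENNReal.ofReal (15 * (n + 1)) ≠ 0 := by
      rw [Ne, ENNReal.ofReal_eq_zero, not_le]; positivity
    have h1 : (A + B) ^ (4 / 3 : ℝ) ≠ 0 := by
      simp only [Ne, ENNReal.rpow_eq_zero_iff, not_or, not_and_or]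
      exact ⟨Or.inl hAB, Or.inl hABtop⟩
    have h2 : W ^ (2 / 3 : ℝ) ≠ 0 := by
      simp only [Ne, ENNReal.rpow_eq_zero_iff, not_or, not_and_or]
      exact ⟨Or.inl hW0, Or.inl hW⟩
    rw [hH, ENNReal.top_rpow_of_pos (by norm_num), ENNReal.mul_top hC, ENNReal.top_mul h1,
      ENNReal.top_mul h2]
    exact le_top
  have hABr : A.toReal + B.toReal = (A + B).toReal := (ENNReal.toReal_add hA hB).symm
  have hMpos : 0 < A.toReal + B.toReal := by
    rw [hABr]; exact ENNReal.toReal_pos hAB hABtop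
  have key := le_rpow_of_forall_scale_le (N := n + 1) (M := A.toReal + B.toReal)
    (X := eLpNorm (fun x => gradient u x - gradient v x) 2 μ ^ 2)
    (by positivity) hMpos hH hW hW0 ?_
  · rwa [hABr, ENNReal.ofReal_toReal hABtop] at key
  intro l hl
  have hpartial := fun i : Fin (n + 1) => lintegral_sq_partial_sub_le i hK hu.continuousOn
    hv.continuousOn hcu hcv hl ENNReal.toReal_nonneg ENNReal.toReal_nonneg hMpos (hgrad hu)
    (hgrad hv)
  have hm : ∀ i : Fin (n + 1), Measurable fun x =>
      ENNReal.ofReal ((gradient u x i - gradient v x i) ^ 2) := by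
    intro i
    have h : Continuous fun x : EuclideanSpace ℝ (Fin (n + 1)) => x i := by fun_prop
    exact (((h.measurable.comp (measurable_gradient u)).sub
      (h.measurable.comp (measurable_gradient v))).pow_const 2).ennreal_ofReal
  calc eLpNorm (fun x => gradient u x - gradient v x) 2 μ ^ 2
      = ∑ i, ∫⁻ x, ENNReal.ofReal ((gradient u x i - gradient v x i) ^ 2) ∂μ := by
        rw [eLpNorm_two_sq_eq_lintegral, ← lintegral_finsetSum _ fun i _ => hm i]
        congr 1; ext x
        rw [EuclideanSpace.real_norm_sq_eq, ENNReal.ofReal_sum_of_nonneg fun i _ => sq_nonneg _]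
        rfl
    _ ≤ ∑ _i : Fin (n + 1), (ENNReal.ofReal (9 * (A.toReal + B.toReal) ^ 2 * l)
          * μH[(n : ℝ)] (frontier K) + ENNReal.ofReal (6 / l ^ 2) * W ^ 2) := by
        refine Finset.sum_le_sum fun i _ => (hpartial i).trans (le_of_eq ?_)
        rw [hWdef, eLpNorm_two_sq_eq_lintegral]
        simp only [Real.norm_eq_abs, sq_abs, hμ]
    _ = _ := by
        rw [Finset.sum_const, nsmul_eq_mul, Finset.card_univ, Fintype.card_fin,
          ← ENNReal.ofReal_natCast]
        push_cast
        rfl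

theorem mainTheorem7 (d : ℕ) (hd : 1 ≤ d) :
    ∃ C : ℝ≥0, ∀ (K : Set (EuclideanSpace ℝ (Fin d))) (u v : EuclideanSpace ℝ (Fin d) → ℝ),
      IsCompact K → IsHausdorffRectifiable (d - 1) (frontier K) →
      (∃ L : ℝ≥0, LipschitzOnWith L u K) → (∃ L : ℝ≥0, LipschitzOnWith L v K) →
      ConvexOnSegments K u → ConvexOnSegments K v →
      eLpNorm (fun x => gradientWithin u K x - gradientWithin v K x) 2 (volume.restrict K) ^ 2 ≤
        (C : ℝ≥0∞) * μH[((d - 1 : ℕ) : ℝ)] (frontier K) ^ (2 / 3 : ℝ)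
          * (eLpNorm (gradientWithin u K) ∞ (volume.restrict K)
              + eLpNorm (gradientWithin v K) ∞ (volume.restrict K)) ^ (4 / 3 : ℝ)
          * eLpNorm (fun x => u x - v x) 2 (volume.restrict K) ^ (2 / 3 : ℝ) := by
  obtain ⟨n, rfl⟩ := Nat.exists_eq_add_of_le' hd
  refine ⟨Real.toNNReal (15 * (n + 1)), ?_⟩
  rintro K u v hK hrect ⟨L, hu⟩ ⟨L', hv⟩ hcu hcv
  rw [Nat.add_sub_cancel] at hrect ⊢
  -- `K` and its interior differ by a subset of the null frontier; on the interior `gradientWithin`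
  -- is the ordinary gradient.
  have hKi : (K : Set (EuclideanSpace ℝ (Fin (n + 1)))) =ᵐ[volume] interior K := by
    refine Filter.EventuallyLE.antisymm ?_ interior_subset.eventuallyLE
    rw [ae_le_set]
    refine measure_mono_null ?_ hrect.volume_eq_zero
    exact fun x hx => ⟨subset_closure hx.1, hx.2⟩
  rw [Measure.restrict_congr_set hKi]
  have hg : ∀ w : EuclideanSpace ℝ (Fin (n + 1)) → ℝ,
      gradientWithin w K =ᵐ[volume.restrict (interior K)] gradient w := fun w =>
    ae_restrict_of_forall_mem isOpen_interior.measurableSet fun x hx =>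
      gradientWithin_of_mem_interior hx
  have hsub : (fun x => gradientWithin u K x - gradientWithin v K x)
      =ᵐ[volume.restrict (interior K)] fun x => gradient u x - gradient v x := (hg u).sub (hg v)
  rw [eLpNorm_congr_ae hsub, eLpNorm_congr_ae (hg u), eLpNorm_congr_ae (hg v)]
  exact eLpNorm_gradient_sub_sq_le hK hu hv hcu hcv

end Main
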